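/- Permutations are finite, of any length $n\ge 0$, and are plotted as the points $(i,\pi(i))$. A permutation $\sigma$ is contained in $\pi$ if some subsequence of the entries of $\pi$ has the same relative ordering as $\sigma$. A permutation class is a set of permutations that is closed downwards under containment and (by convention) contains the empty permutation. The basis of a class $\mathcal{C}$ is the minimal set $B$ such that $\mathcal{C}=\operatorname{Av}(B)$, the set of permutations containing no element of $B$; $\mathcal{C}$ is finitely based if its basis is finite. For permutation classes $\mathcal{A}_{11},\mathcal{A}_{12},\mathcal{A}_{21},\mathcal{A}_{22}$, the grid class $\operatorname{Grid}\begin{pmatrix}\mathcal{A}_{11}&\mathcal{A}_{12}\\ \mathcal{A}_{21}&\mathcal{A}_{22}\end{pmatrix}$ is the class of all permutations whose plot can be divided by one vertical and one horizontal line into four (possibly empty) cells, placed as in the matrix, such that the entries in each cell form a copy of a permutation from the class in the corresponding matrix entry. Theorem. Let $\mathcal{C}$ and $\mathcal{D}$ be finitely based permutation classes. Then the three grid classes $$\operatorname{Grid}\begin{pmatrix}\mathcal{C}&\mathcal{D}\\ \operatorname{Av}(21)&\operatorname{Av}(21)\end{pmatrix},\qquad \operatorname{Grid}\begin{pmatrix}\mathcal{C}&\mathcal{D}\\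 \operatorname{Av}(21)&\operatorname{Av}(12)\end{pmatrix},\qquad \operatorname{Grid}\begin{pmatrix}\mathcal{C}&\mathcal{D}\\ \operatorname{Av}(12)&\operatorname{Av}(21)\end{pmatrix}$$ are all finitely based. Here $\operatorname{Av}(21)$ is the class of increasing permutations and $\operatorname{Av}(12)$ the class of decreasing permutations. -/

import Mathlib

namespace PermPattern

/-- A finite permutation of any length `n ≥ 0`; `π.1` is the length. Positions and values are
numbered from `0`, and the plot of `π` is the set of points `(i, π.2 i)`. -/
abbrev Permutation : Type := Σ n : ℕ, Equiv.Perm (Fin n)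

/-- The entries of `π` in the set of positions `S` form a copy of `σ`: they are as many as the
entries of `σ`, and have the same relative ordering. -/
def IsCopy (σ π : Permutation) (S : Set (Fin π.1)) : Prop :=
  ∃ f : Fin σ.1 ↪o Fin π.1, Set.range f = S ∧
    ∀ i j : Fin σ.1, σ.2 i < σ.2 j ↔ π.2 (f i) < π.2 (f j)

/-- `σ` is contained in `π`: some entries of `π` form a copy of `σ`. -/
def Contained (σ π : Permutation) : Prop := ∃ S : Set (Fin π.1), IsCopy σ π S

/-- The empty permutation. -/
def emptyPerm : Permutation := ⟨0, 1⟩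

/-- The permutation `12`. -/
def perm12 : Permutation := ⟨2, 1⟩

/-- The permutation `21`. -/
def perm21 : Permutation := ⟨2, Equiv.swap 0 1⟩

/-- A permutation class: a set of permutations that is closed downwards under containment. By
convention the empty permutation belongs to every permutation class. -/
structure IsPermClass (C : Set Permutation) : Prop where
  empty_mem : emptyPerm ∈ C
  down_closed : ∀ π ∈ C, ∀ σ, Contained σ π → σ ∈ C

/-- The permutations that avoid (do not contain) every element of `B`. -/
def Av (B : Set Permutation) : Set Permutation := {π | ∀ β ∈ B, ¬ Contained β π}

/-- `B` is the basis of `C`: `C = Av B`, and `B` is minimal (under inclusion) with this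
property. -/
def IsBasis (B C : Set Permutation) : Prop := Minimal (fun B' => C = Av B') B

/-- `C` is finitely based: it has a finite basis. -/
def FinitelyBased (C : Set Permutation) : Prop := ∃ B : Set Permutation, IsBasis B C ∧ B.Finite

/-- The increasing permutations. -/
def Increasing : Set Permutation := Av {perm21}

/-- The decreasing permutations. -/
def Decreasing : Set Permutation := Av {perm12}

/-- The entries of `π` in the set of positions `S` form a copy of a permutation from `A`. -/
def CellIn (A : Set Permutation) (π : Permutation) (S : Set (Fin π.1)) : Prop :=
  ∃ σ ∈ A, IsCopy σ π S

/-- The grid class of a `2 × 2` matrix of sets of permutations; row `0` of the matrix is the top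
row of the picture. The vertical line has exactly the positions `< v` on its left, and the
horizontal line has exactly the values `< h` below it. -/
def Grid (M : Matrix (Fin 2) (Fin 2) (Set Permutation)) : Set Permutation :=
  {π | ∃ v h : ℕ,
    CellIn (M 0 0) π {i | (i : ℕ) < v ∧ h ≤ (π.2 i : ℕ)} ∧
    CellIn (M 0 1) π {i | v ≤ (i : ℕ) ∧ h ≤ (π.2 i : ℕ)} ∧
    CellIn (M 1 0) π {i | (i : ℕ) < v ∧ (π.2 i : ℕ) < h} ∧
    CellIn (M 1 1) π {i | v ≤ (i : ℕ) ∧ (π.2 i : ℕ) < h}}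

end PermPattern

/-!
A permutation `π` lies outside the grid class exactly when every horizontal line `h` fails with
every vertical line. For a fixed `h`, the admissible vertical lines are bounded on the right by
forbidden sets of the left cells and on the left by forbidden sets of the right cells, so two
forbidden sets `X`, `Y`, with `X` weakly on the left of `Y`, already exclude them all
(`blocked_of_obstructed`). It remains to choose boundedly many entries of `π` that do this for all
`h` at once (`exists_bounded_blocked`); a bound on the size of the obstructions gives a finite basis
(`finitelyBased_of_bounded`).

If `X` and `Y` both lie in the bottom row, they block all higher lines as well, so the lowest such
`h` needs one choice; symmetrically for the top row. The other possibility is a diagonal pair, which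
blocks an interval of heights: a copy of a basis element in a top cell and a pair of entries
violating monotonicity in the opposite bottom cell. Such intervals are chosen greedily from the
bottom up (`Rung`, `exists_rung`), the violating pair as far inwards as possible and then the copy
as high as possible. Each rung then moves strictly beyond the previous one (`Rung.lt`), and for the
three matrices at hand, among the points of two or three successive rungs there are violating
pairs of both bottom cells that block the bottom row (the lemmas `rungBound_…`). Hence two
rungs suffice for either diagonal (`exists_diagonal_cover`). The two diagonals are mirror images of each other, and are treated at
once by letting the position of an entry be an arbitrary integer-valued function, `i` or `-i`.
-/

namespace PermPattern

/-! ### Copies and cells -/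

lemma IsCopy.image {σ π τ : Permutation} {f : Fin σ.1 ↪o Fin π.1}
    (hf : ∀ i j, σ.2 i < σ.2 j ↔ π.2 (f i) < π.2 (f j)) {T : Set (Fin σ.1)}
    (hT : IsCopy τ σ T) : IsCopy τ π (f '' T) := by
  obtain ⟨g, rfl, hg⟩ := hT
  refine ⟨g.trans f, ?_, fun i j => (hg i j).trans (hf _ _)⟩
  ext x
  simp

lemma IsCopy.exists_preimage {σ π τ : Permutation} {f : Fin σ.1 ↪o Fin π.1}
    (hf : ∀ i j, σ.2 i < σ.2 j ↔ π.2 (f i) < π.2 (f j)) {T : Set (Fin π.1)}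
    (hT : IsCopy τ π T) (hsub : T ⊆ Set.range f) :
    ∃ T' : Set (Fin σ.1), IsCopy τ σ T' ∧ f '' T' = T := by
  obtain ⟨g, rfl, hg⟩ := hT
  choose e he using fun j => hsub (Set.mem_range_self j)
  have hmono : StrictMono e := fun i j hij => by
    rw [← f.lt_iff_lt, he, he]
    exact g.strictMono hij
  refine ⟨Set.range e, ⟨OrderEmbedding.ofStrictMono e hmono, rfl, fun i j => ?_⟩, ?_⟩
  · rw [hg i j, hf]
    simp [he]
  · ext x
    simp [he]

/-- Standardization: the entries at any set of positions form a copy of a permutation. -/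
lemma exists_isCopy (π : Permutation) (S : Set (Fin π.1)) : ∃ σ, IsCopy σ π S := by
  classical
  set s : Finset (Fin π.1) := S.toFinset with hs
  have hcard : (s.map π.2.toEmbedding).card = s.card := Finset.card_map _
  let g := (s.map π.2.toEmbedding).orderIsoOfFin hcard
  let f := s.orderEmbOfFin rfl
  have hmem : ∀ j, π.2 (f j) ∈ s.map π.2.toEmbedding := fun j =>
    Finset.mem_map_of_mem π.2.toEmbedding (s.orderEmbOfFin_mem rfl j)
  let q : Fin s.card → Fin s.card := fun j => g.symm ⟨π.2 (f j), hmem j⟩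
  have hq : Function.Injective q := fun i j hij => by
    have := g.symm.injective hij
    simpa using this
  refine ⟨⟨s.card, Equiv.ofBijective q (Finite.injective_iff_bijective.mp hq)⟩, f, ?_, ?_⟩
  · simp [f, hs]
  · intro i j
    change q i < q j ↔ _
    simp [q]

lemma IsCopy.nonempty {σ π : Permutation} {S : Set (Fin π.1)} (h : IsCopy σ π S)
    (hσ : σ ≠ emptyPerm) : S.Nonempty := by
  obtain ⟨f, rfl, -⟩ := h
  rcases σ with ⟨_ | n, s⟩
  · exact absurd (by rw [emptyPerm, Subsingleton.elim s 1]) hσ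
  · exact ⟨f ⟨0, n.succ_pos⟩, Set.mem_range_self _⟩

lemma IsCopy.ncard_eq {σ π : Permutation} {S : Set (Fin π.1)} (h : IsCopy σ π S) :
    S.ncard = σ.1 := by
  obtain ⟨f, rfl, -⟩ := h
  rw [← Set.image_univ, Set.ncard_image_of_injective _ f.injective, Set.ncard_univ]
  simp

/-- The sets of positions of `π` whose entries form a copy of an element of `B`. -/
def occ (B : Set Permutation) (π : Permutation) : Set (Set (Fin π.1)) :=
  {T | ∃ β ∈ B, IsCopy β π T}

lemma cellIn_Av_iff {B : Set Permutation} {π : Permutation} {S : Set (Fin π.1)} :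
    CellIn (Av B) π S ↔ ∀ T ∈ occ B π, ¬ T ⊆ S := by
  constructor
  · rintro ⟨σ, hσ, f, rfl, hf⟩ T ⟨β, hβ, hT⟩ hTS
    obtain ⟨T', hT', -⟩ := hT.exists_preimage hf hTS
    exact hσ β hβ ⟨T', hT'⟩
  · intro h
    obtain ⟨σ, f, rfl, hf⟩ := exists_isCopy π S
    refine ⟨σ, ?_, f, rfl, hf⟩
    rintro β hβ ⟨T, hT⟩
    exact h _ ⟨β, hβ, hT.image hf⟩ (Set.image_subset_range _ _)

lemma occ_pair (s : Equiv.Perm (Fin 2)) (π : Permutation) :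
    occ {⟨2, s⟩} π = {T | ∃ i j, (i < j ∧ (s 0 < s 1 ↔ π.2 i < π.2 j)) ∧ T = {i, j}} := by
  ext T
  constructor
  · rintro ⟨_, rfl, f, rfl, hf⟩
    refine ⟨f (0 : Fin 2), f (1 : Fin 2),
      ⟨f.strictMono (show (0 : Fin 2) < 1 by decide), hf (0 : Fin 2) (1 : Fin 2)⟩, ?_⟩
    ext x
    change (∃ y : Fin 2, _) ↔ _
    simp [Fin.exists_fin_two, eq_comm]
  · rintro ⟨i, j, ⟨hij, hs⟩, rfl⟩
    obtain ⟨g, rfl, rfl⟩ : ∃ g : Fin 2 ↪o Fin π.1, g 0 = i ∧ g 1 = j := by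
      refine ⟨OrderEmbedding.ofStrictMono ![i, j] ?_, rfl, rfl⟩
      intro a b hab
      fin_cases a <;> fin_cases b <;> simp_all
    refine ⟨_, rfl, g, ?_, ?_⟩
    · ext x
      simp [Fin.exists_fin_two, eq_comm]
    · have hne : π.2 (g 0) ≠ π.2 (g 1) := fun h => hij.ne (π.2.injective h)
      have hne' : s 0 ≠ s 1 := fun h => absurd (s.injective h) (by decide)
      change ∀ a b : Fin 2, _
      simp only [Fin.forall_fin_two, lt_self_iff_false, true_and, and_true]
      exact ⟨hs, by rw [← not_le, ← not_le, hne'.le_iff_lt, hne.le_iff_lt, hs]⟩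

lemma occ_perm12 (π : Permutation) :
    occ {perm12} π = {T | ∃ i j, (i < j ∧ π.2 i < π.2 j) ∧ T = {i, j}} := by
  simp [perm12, occ_pair]

lemma occ_perm21 (π : Permutation) :
    occ {perm21} π = {T | ∃ i j, (i < j ∧ π.2 j < π.2 i) ∧ T = {i, j}} := by
  rw [perm21, occ_pair]
  ext T
  refine exists_congr fun i => exists_congr fun j => and_congr_left fun _ =>
    and_congr_right fun hij => ?_
  have hne : π.2 i ≠ π.2 j := fun h => hij.ne (π.2.injective h)
  rw [← not_iff_not, not_lt, hne.le_iff_lt]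
  simp

/-! ### Finite bases from bounded obstructions -/

lemma finite_length_le (K : ℕ) : {σ : Permutation | σ.1 ≤ K}.Finite := by
  refine ((Finset.range (K + 1)).sigma fun n =>
    (Finset.univ : Finset (Equiv.Perm (Fin n)))).finite_toSet.subset ?_
  rintro ⟨n, s⟩ h
  have h' : n ≤ K := h
  simp
  omega

/-- A downward closed set is finitely based if every permutation outside it has boundedly many
entries which form a permutation outside it. -/
lemma finitelyBased_of_bounded {C : Set Permutation}
    (hdown : ∀ π ∈ C, ∀ σ, Contained σ π → σ ∈ C) (K : ℕ)
    (hK : ∀ π ∉ C, ∃ S : Set (Fin π.1), S.ncard ≤ K ∧ ∀ σ, IsCopy σ π S → σ ∉ C) :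
    FinitelyBased C := by
  set B : Set Permutation := {σ | σ.1 ≤ K ∧ σ ∉ C}
  have hB : B.Finite := (finite_length_le K).subset fun _ h => h.1
  have hCB : C = Av B := by
    ext π
    refine ⟨fun hπ β hβ hc => hβ.2 (hdown π hπ β hc), fun hπ => ?_⟩
    by_contra hn
    obtain ⟨S, hS, hbad⟩ := hK π hn
    obtain ⟨σ, hσ⟩ := exists_isCopy π S
    exact hπ σ ⟨hσ.ncard_eq ▸ hS, hbad σ hσ⟩ ⟨S, hσ⟩
  -- a minimal element among the finitely many subsets of `B` that define `C`
  have hfin : {B' : Set Permutation | B' ⊆ B ∧ C = Av B'}.Finite :=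
    hB.finite_subsets.subset fun _ h => h.1
  obtain ⟨B₀, hB₀⟩ := hfin.exists_minimal ⟨B, subset_rfl, hCB⟩
  exact ⟨B₀, ⟨hB₀.prop.2, fun B' hB' hle => hB₀.le_of_le ⟨hle.trans hB₀.prop.1, hB'⟩ hle⟩,
    hB.subset hB₀.prop.1⟩

/-! ### Greedy covers -/

section Greedy

variable {ι : Type*} {p : ι → ℤ} {a : ι → ℕ} {𝓜 : Set (Set ι)} {R : ι → ι → Prop}

/-- Points `i : ι` have position `p i` and height `a i`. The height `h` is obstructed diagonally
inside `S`: a set of `𝓜` above `h` lies weakly on the left of the point `x` of a pair `R x y`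
below `h`. -/
def Diagonal (p : ι → ℤ) (a : ι → ℕ) (𝓜 : Set (Set ι)) (R : ι → ι → Prop) (S : Set ι) (h : ℕ) :
    Prop :=
  ∃ M ∈ 𝓜, ∃ x y, M ⊆ S ∧ x ∈ S ∧ y ∈ S ∧ (∀ i ∈ M, h ≤ a i) ∧ R x y ∧ a x < h ∧ a y < h ∧
    ∀ i ∈ M, p i ≤ p x

/-- A diagonal obstruction of the heights from `h` to `u`, chosen greedily: the point `x` is as far
to the right as possible for `h`, then the set `M`, with lowest point `m`, is as high as possible
for `x`. -/
structure Rung (p : ι → ℤ) (a : ι → ℕ) (𝓜 : Set (Set ι)) (R : ι → ι → Prop)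
    (h u : ℕ) (x y m : ι) (M : Set ι) : Prop where
  rel : R x y
  x_lt : a x < h
  y_lt : a y < h
  best : ∀ x' y', R x' y' → a x' < h → a y' < h → p x' ≤ p x
  mem : M ∈ 𝓜
  left : ∀ i ∈ M, p i ≤ p x
  m_mem : m ∈ M
  m_eq : a m = u
  low : ∀ i ∈ M, u ≤ a i
  le : h ≤ u
  top : ∀ M' ∈ 𝓜, (∀ i ∈ M', p i ≤ p x) → ∃ i ∈ M', a i ≤ u

/-- The greedy choice: above any threshold `t` with a diagonally obstructed height there is a rung
that starts at the least such height. -/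
lemma exists_rung [Finite ι] (hne : ∀ M ∈ 𝓜, M.Nonempty) {t h₀ : ℕ} (ht : t ≤ h₀)
    (hD : Diagonal p a 𝓜 R Set.univ h₀) :
    ∃ h u x y m M, Rung p a 𝓜 R h u x y m M ∧ t ≤ h ∧
      ∀ h', t ≤ h' → Diagonal p a 𝓜 R Set.univ h' → h ≤ h' := by
  classical
  have hex : ∃ h, t ≤ h ∧ Diagonal p a 𝓜 R Set.univ h := ⟨h₀, ht, hD⟩
  obtain ⟨hth, M₀, hM₀, x₀, y₀, -, -, -, habove, hR₀, hx₀, hy₀, hleft₀⟩ := Nat.find_spec hex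
  set h := Nat.find hex
  obtain ⟨x, ⟨y, hR, hx, hy⟩, hbest⟩ :=
    Set.exists_max_image {x | ∃ y, R x y ∧ a x < h ∧ a y < h} p (Set.toFinite _)
      ⟨x₀, y₀, hR₀, hx₀, hy₀⟩
  have hx₀x : p x₀ ≤ p x := hbest x₀ ⟨y₀, hR₀, hx₀, hy₀⟩
  have hlow : ∀ M ∈ 𝓜, ∃ m ∈ M, ∀ i ∈ M, a m ≤ a i := fun M hM =>
    Set.exists_min_image M a (Set.toFinite _) (hne M hM)
  obtain ⟨m₀, hm₀, hmin₀⟩ := hlow M₀ hM₀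
  have hM₀x : ∀ i ∈ M₀, p i ≤ p x := fun i hi => (hleft₀ i hi).trans hx₀x
  obtain ⟨m, ⟨M, hM, hMx, hm, hmin⟩, hmax⟩ :=
    Set.exists_max_image {m | ∃ M ∈ 𝓜, (∀ i ∈ M, p i ≤ p x) ∧ m ∈ M ∧ ∀ i ∈ M, a m ≤ a i} a
      (Set.toFinite _) ⟨m₀, M₀, hM₀, hM₀x, hm₀, hmin₀⟩
  refine ⟨h, a m, x, y, m, M,
    ⟨hR, hx, hy, fun x' y' h1 h2 h3 => hbest x' ⟨y', h1, h2, h3⟩, hM, hMx, hm, rfl, hmin,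
      (habove m₀ hm₀).trans (hmax m₀ ⟨M₀, hM₀, hM₀x, hm₀, hmin₀⟩), fun M' hM' hM'x => ?_⟩,
    hth, fun h' h1 h2 => Nat.find_min' hex ⟨h1, h2⟩⟩
  obtain ⟨m', hm', hmin'⟩ := hlow M' hM'
  exact ⟨m', hm', hmax m' ⟨M', hM', hM'x, hm', hmin'⟩⟩

lemma Rung.diagonal {h u : ℕ} {x y m : ι} {M S : Set ι} (r : Rung p a 𝓜 R h u x y m M)
    (hS : M ∪ {x, y} ⊆ S) {h' : ℕ} (h1 : h ≤ h') (h2 : h' ≤ u) : Diagonal p a 𝓜 R S h' :=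
  ⟨M, r.mem, x, y, fun _ hi => hS (.inl hi), hS (by simp), hS (by simp),
    fun i hi => h2.trans (r.low i hi), r.rel, r.x_lt.trans_le h1, r.y_lt.trans_le h1, r.left⟩

/-- Successive rungs move to the right, because the set of the second one is too high to lie on the
left of the first one. -/
lemma Rung.lt {h u h' u' : ℕ} {x y m x' y' m' : ι} {M M' : Set ι}
    (r : Rung p a 𝓜 R h u x y m M) (r' : Rung p a 𝓜 R h' u' x' y' m' M') (hu : u < h') :
    p x < p x' := by
  by_contra hcon
  obtain ⟨i, hi, hiu⟩ := r.top M' r'.mem fun i hi => (r'.left i hi).trans (not_lt.1 hcon)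
  have := r'.low i hi
  have := r'.le
  omega

/-- Any three successive rungs force the property `Q` at the height where the third one starts. -/
def RungBound (p : ι → ℤ) (a : ι → ℕ) (𝓜 : Set (Set ι)) (R : ι → ι → Prop) (Q : ℕ → Prop) :
    Prop :=
  ∀ h₁ u₁ x₁ y₁ m₁ M₁ h₂ u₂ x₂ y₂ m₂ M₂ h₃ u₃ x₃ y₃ m₃ M₃,
    Rung p a 𝓜 R h₁ u₁ x₁ y₁ m₁ M₁ → Rung p a 𝓜 R h₂ u₂ x₂ y₂ m₂ M₂ →
    Rung p a 𝓜 R h₃ u₃ x₃ y₃ m₃ M₃ → u₁ < h₂ → u₂ < h₃ → p x₁ < p x₂ → p x₂ < p x₃ → Q h₃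

lemma RungBound.of_two {Q : ℕ → Prop}
    (h : ∀ h₁ u₁ x₁ y₁ m₁ M₁ h₂ u₂ x₂ y₂ m₂ M₂, Rung p a 𝓜 R h₁ u₁ x₁ y₁ m₁ M₁ →
      Rung p a 𝓜 R h₂ u₂ x₂ y₂ m₂ M₂ → u₁ < h₂ → p x₁ < p x₂ → Q h₂) :
    RungBound p a 𝓜 R Q :=
  fun _ _ _ _ _ _ _ _ _ _ _ _ _ _ _ _ _ _ _ r₂ r₃ _ hu _ hx =>
    h _ _ _ _ _ _ _ _ _ _ _ _ r₂ r₃ hu hx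

/-- If three successive rungs force the upward closed property `Q`, then two of them obstruct all
the diagonally obstructed heights at which `Q` fails. -/
lemma exists_diagonal_cover [Finite ι] {K : ℕ} (hne : ∀ M ∈ 𝓜, M.Nonempty)
    (hK : ∀ M ∈ 𝓜, M.ncard ≤ K) {Q : ℕ → Prop} (hQ : Monotone Q)
    (hrung : RungBound p a 𝓜 R Q) :
    ∃ S : Set ι, S.ncard ≤ 2 * (K + 2) ∧
      ∀ h, Diagonal p a 𝓜 R Set.univ h → Diagonal p a 𝓜 R S h ∨ Q h := by
  have hcard : ∀ M ∈ 𝓜, ∀ x y, (M ∪ {x, y}).ncard ≤ K + 2 := fun M hM x y =>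
    (Set.ncard_union_le _ _).trans (add_le_add (hK M hM) (Set.ncard_insert_le x {y} |>.trans (by simp)))
  by_cases h1 : ∃ h, 0 ≤ h ∧ Diagonal p a 𝓜 R Set.univ h
  swap
  · exact ⟨∅, by simp, fun h hh => absurd ⟨h, h.zero_le, hh⟩ h1⟩
  obtain ⟨_, ht, hD⟩ := h1
  obtain ⟨h₁, u₁, x₁, y₁, m₁, M₁, r₁, -, hmin₁⟩ := exists_rung hne ht hD
  by_cases h2 : ∃ h, u₁ + 1 ≤ h ∧ Diagonal p a 𝓜 R Set.univ h
  swap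
  · refine ⟨M₁ ∪ {x₁, y₁}, (hcard M₁ r₁.mem _ _).trans (by omega), fun h hh => .inl ?_⟩
    refine r₁.diagonal subset_rfl (hmin₁ h h.zero_le hh) ?_
    by_contra hc
    exact h2 ⟨h, by omega, hh⟩
  obtain ⟨_, ht, hD⟩ := h2
  obtain ⟨h₂, u₂, x₂, y₂, m₂, M₂, r₂, hu₁, hmin₂⟩ := exists_rung hne ht hD
  refine ⟨(M₁ ∪ {x₁, y₁}) ∪ (M₂ ∪ {x₂, y₂}), ?_, fun h hh => ?_⟩
  · have := hcard M₁ r₁.mem x₁ y₁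
    have := hcard M₂ r₂.mem x₂ y₂
    have := Set.ncard_union_le (M₁ ∪ {x₁, y₁}) (M₂ ∪ {x₂, y₂})
    omega
  by_cases hhu₁ : h ≤ u₁
  · exact .inl (r₁.diagonal Set.subset_union_left (hmin₁ h h.zero_le hh) hhu₁)
  by_cases hhu₂ : h ≤ u₂
  · exact .inl (r₂.diagonal Set.subset_union_right (hmin₂ h (by omega) hh) hhu₂)
  obtain ⟨h₃, u₃, x₃, y₃, m₃, M₃, r₃, hu₂, hmin₃⟩ :=
    exists_rung hne (t := u₂ + 1) (by omega : u₂ + 1 ≤ h) hh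
  exact .inr (hQ (hmin₃ h (by omega) hh)
    (hrung _ _ _ _ _ _ _ _ _ _ _ _ _ _ _ _ _ _ r₁ r₂ r₃ hu₁ hu₂ (r₁.lt r₂ hu₁) (r₂.lt r₃ hu₂)))

end Greedy

/-! ### Obstructed heights -/

section Blocked

variable {n : ℕ} {a : Fin n → ℕ} {𝓒 𝓓 𝓛 𝓡 : Set (Set (Fin n))} {S : Set (Fin n)}

/-- No vertical line goes with the horizontal line at height `h`, because of points of `S`: there
are a forbidden set `X` of one of the left cells and a forbidden set `Y` of one of the right cells,
with `X` weakly on the left of `Y`. Here `𝓒`, `𝓓`, `𝓛`, `𝓡` are the sets that must not be contained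
in the top left, top right, bottom left and bottom right cell. -/
def Blocked (a : Fin n → ℕ) (𝓒 𝓓 𝓛 𝓡 : Set (Set (Fin n))) (S : Set (Fin n)) (h : ℕ) : Prop :=
  ∃ X Y, X ⊆ S ∧ Y ⊆ S ∧ (X ∈ 𝓒 ∧ (∀ i ∈ X, h ≤ a i) ∨ X ∈ 𝓛 ∧ ∀ i ∈ X, a i < h) ∧
    (Y ∈ 𝓓 ∧ (∀ i ∈ Y, h ≤ a i) ∨ Y ∈ 𝓡 ∧ ∀ i ∈ Y, a i < h) ∧ ∀ i ∈ X, ∀ j ∈ Y, i ≤ j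

/-- Every vertical line `v`, together with the horizontal line `h`, has a forbidden set of one of
the four families in its cell. -/
def Obstructed (a : Fin n → ℕ) (𝓒 𝓓 𝓛 𝓡 : Set (Set (Fin n))) (S : Set (Fin n)) (v h : ℕ) : Prop :=
  ∃ T ⊆ S, T ∈ 𝓒 ∧ (∀ i ∈ T, (i : ℕ) < v ∧ h ≤ a i) ∨ T ∈ 𝓓 ∧ (∀ i ∈ T, v ≤ (i : ℕ) ∧ h ≤ a i) ∨
    T ∈ 𝓛 ∧ (∀ i ∈ T, (i : ℕ) < v ∧ a i < h) ∨ T ∈ 𝓡 ∧ (∀ i ∈ T, v ≤ (i : ℕ) ∧ a i < h)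

lemma Blocked.mono {S' : Set (Fin n)} {h : ℕ} (hb : Blocked a 𝓒 𝓓 𝓛 𝓡 S h) (hS : S ⊆ S') :
    Blocked a 𝓒 𝓓 𝓛 𝓡 S' h := by
  obtain ⟨X, Y, hX, hY, hb⟩ := hb
  exact ⟨X, Y, hX.trans hS, hY.trans hS, hb⟩

lemma Blocked.obstructed {h : ℕ} (hb : Blocked a 𝓒 𝓓 𝓛 𝓡 S h) (v : ℕ) :
    Obstructed a 𝓒 𝓓 𝓛 𝓡 S v h := by
  obtain ⟨X, Y, hXS, hYS, hX, hY, hXY⟩ := hb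
  by_cases hv : ∀ i ∈ X, (i : ℕ) < v
  · rcases hX with ⟨h1, h2⟩ | ⟨h1, h2⟩
    · exact ⟨X, hXS, .inl ⟨h1, fun i hi => ⟨hv i hi, h2 i hi⟩⟩⟩
    · exact ⟨X, hXS, .inr <| .inr <| .inl ⟨h1, fun i hi => ⟨hv i hi, h2 i hi⟩⟩⟩
  · push Not at hv
    obtain ⟨i, hi, hvi⟩ := hv
    have hv' : ∀ j ∈ Y, v ≤ (j : ℕ) := fun j hj => hvi.trans (hXY i hi j hj)
    rcases hY with ⟨h1, h2⟩ | ⟨h1, h2⟩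
    · exact ⟨Y, hYS, .inr <| .inl ⟨h1, fun i hi => ⟨hv' i hi, h2 i hi⟩⟩⟩
    · exact ⟨Y, hYS, .inr <| .inr <| .inr ⟨h1, fun i hi => ⟨hv' i hi, h2 i hi⟩⟩⟩

/-- A one-dimensional Helly property: if no vertical line works, then two forbidden sets already
exclude them all. -/
lemma blocked_of_obstructed {h : ℕ} (h𝓒 : ∀ T ∈ 𝓒, T.Nonempty) (h𝓓 : ∀ T ∈ 𝓓, T.Nonempty)
    (h𝓛 : ∀ T ∈ 𝓛, T.Nonempty) (h𝓡 : ∀ T ∈ 𝓡, T.Nonempty)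
    (hv : ∀ v, Obstructed a 𝓒 𝓓 𝓛 𝓡 S v h) : Blocked a 𝓒 𝓓 𝓛 𝓡 S h := by
  classical
  have key : ∀ v, (∃ X ⊆ S, (X ∈ 𝓒 ∧ (∀ i ∈ X, h ≤ a i) ∨ X ∈ 𝓛 ∧ ∀ i ∈ X, a i < h) ∧
        ∀ i ∈ X, (i : ℕ) < v) ∨
      ∃ Y ⊆ S, (Y ∈ 𝓓 ∧ (∀ i ∈ Y, h ≤ a i) ∨ Y ∈ 𝓡 ∧ ∀ i ∈ Y, a i < h) ∧
        ∀ i ∈ Y, v ≤ (i : ℕ) := by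
    intro v
    obtain ⟨T, hT, ⟨h1, h2⟩ | ⟨h1, h2⟩ | ⟨h1, h2⟩ | ⟨h1, h2⟩⟩ := hv v
    · exact .inl ⟨T, hT, .inl ⟨h1, fun i hi => (h2 i hi).2⟩, fun i hi => (h2 i hi).1⟩
    · exact .inr ⟨T, hT, .inl ⟨h1, fun i hi => (h2 i hi).2⟩, fun i hi => (h2 i hi).1⟩
    · exact .inl ⟨T, hT, .inr ⟨h1, fun i hi => (h2 i hi).2⟩, fun i hi => (h2 i hi).1⟩
    · exact .inr ⟨T, hT, .inr ⟨h1, fun i hi => (h2 i hi).2⟩, fun i hi => (h2 i hi).1⟩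
  have hex : ∃ v, ∃ X ⊆ S, (X ∈ 𝓒 ∧ (∀ i ∈ X, h ≤ a i) ∨ X ∈ 𝓛 ∧ ∀ i ∈ X, a i < h) ∧
      ∀ i ∈ X, (i : ℕ) < v := by
    refine ⟨n, (key n).resolve_right ?_⟩
    rintro ⟨Y, -, hY, hYn⟩
    obtain ⟨i, hi⟩ : Y.Nonempty := hY.elim (fun h => h𝓓 Y h.1) fun h => h𝓡 Y h.1
    exact absurd (hYn i hi) (by omega)
  obtain ⟨X, hXS, hX, hXv⟩ := Nat.find_spec hex
  obtain ⟨i₀, hi₀⟩ : X.Nonempty := hX.elim (fun h => h𝓒 X h.1) fun h => h𝓛 X h.1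
  have hpos := hXv i₀ hi₀
  -- the last line with no forbidden set on its left has a forbidden set on its right
  obtain ⟨Y, hYS, hY, hYv⟩ := (key (Nat.find hex - 1)).resolve_left
    (Nat.find_min hex (by omega))
  refine ⟨X, Y, hXS, hYS, hX, hY, fun i hi j hj => ?_⟩
  have := hXv i hi
  have := hYv j hj
  rw [Fin.le_def]
  omega

/-- A pair of the bottom left cell and a pair of the bottom right cell, both below `h`, exclude
every vertical line. -/
def RowBlocked (a : Fin n → ℕ) (RL RR : Fin n → Fin n → Prop) (h : ℕ) : Prop :=
  ∃ i j k l, RL i j ∧ RR k l ∧ j ≤ k ∧ a i < h ∧ a j < h ∧ a k < h ∧ a l < h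

lemma rowBlocked_mono (RL RR : Fin n → Fin n → Prop) : Monotone (RowBlocked a RL RR) := by
  rintro h h' hh ⟨i, j, k, l, h1, h2, h3, h4, h5, h6, h7⟩
  exact ⟨i, j, k, l, h1, h2, h3, by omega, by omega, by omega, by omega⟩

/-- If the horizontal line is blocked at every height, then it is so by boundedly many points: at
most `2 * K` for the top row, `4` for the bottom row, and `2 * (K + 2)` for each diagonal. -/
theorem exists_bounded_blocked {RL RR : Fin n → Fin n → Prop} {K : ℕ}
    (h𝓒 : ∀ T ∈ 𝓒, T.Nonempty) (h𝓓 : ∀ T ∈ 𝓓, T.Nonempty)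
    (h𝓒K : ∀ T ∈ 𝓒, T.ncard ≤ K) (h𝓓K : ∀ T ∈ 𝓓, T.ncard ≤ K)
    (hL : 𝓛 = {T | ∃ i j, RL i j ∧ T = {i, j}}) (hR : 𝓡 = {T | ∃ i j, RR i j ∧ T = {i, j}})
    (hRL : ∀ i j, RL i j → i < j) (hRR : ∀ i j, RR i j → i < j)
    (hleft : RungBound (fun i : Fin n => (i : ℤ)) a 𝓒 RR (RowBlocked a RL RR))
    (hright : RungBound (fun i : Fin n => -(i : ℤ)) a 𝓓 (fun x y => RL y x) (RowBlocked a RL RR))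
    (hb : ∀ h, Blocked a 𝓒 𝓓 𝓛 𝓡 Set.univ h) :
    ∃ S : Set (Fin n), S.ncard ≤ 6 * K + 12 ∧ ∀ h, Blocked a 𝓒 𝓓 𝓛 𝓡 S h := by
  classical
  subst hL hR
  obtain ⟨S₁, hS₁, hcov₁⟩ := exists_diagonal_cover h𝓒 h𝓒K (rowBlocked_mono RL RR) hleft
  obtain ⟨S₂, hS₂, hcov₂⟩ := exists_diagonal_cover h𝓓 h𝓓K (rowBlocked_mono RL RR) hright
  -- the lowest height at which the bottom row is blocked serves for all higher ones
  obtain ⟨S₃, hS₃, hcov₃⟩ : ∃ S : Set (Fin n), S.ncard ≤ 4 ∧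
      ∀ h, RowBlocked a RL RR h → ∃ i j k l, i ∈ S ∧ j ∈ S ∧ k ∈ S ∧ l ∈ S ∧
        RL i j ∧ RR k l ∧ j ≤ k ∧ a i < h ∧ a j < h ∧ a k < h ∧ a l < h := by
    by_cases hex : ∃ h, RowBlocked a RL RR h
    · obtain ⟨i, j, k, l, h1, h2, h3, h4, h5, h6, h7⟩ := Nat.find_spec hex
      refine ⟨{i, j, k, l}, ?_, fun h hh => ?_⟩
      · have := Set.ncard_insert_le i {j, k, l}
        have := Set.ncard_insert_le j {k, l}
        have := Set.ncard_insert_le k {l}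
        have := Set.ncard_singleton l
        omega
      · have := Nat.find_min' hex hh
        exact ⟨i, j, k, l, by simp, by simp, by simp, by simp, h1, h2, h3, by omega, by omega,
          by omega, by omega⟩
    · exact ⟨∅, by simp, fun h hh => absurd ⟨h, hh⟩ hex⟩
  -- the highest height at which the top row is blocked serves for all lower ones
  obtain ⟨S₄, hS₄, hcov₄⟩ : ∃ S : Set (Fin n), S.ncard ≤ 2 * K ∧
      ∀ h, (∃ X ∈ 𝓒, ∃ Y ∈ 𝓓, (∀ i ∈ X, h ≤ a i) ∧ (∀ i ∈ Y, h ≤ a i) ∧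
        ∀ i ∈ X, ∀ j ∈ Y, i ≤ j) → ∃ X ∈ 𝓒, ∃ Y ∈ 𝓓, X ⊆ S ∧ Y ⊆ S ∧
        (∀ i ∈ X, h ≤ a i) ∧ (∀ i ∈ Y, h ≤ a i) ∧ ∀ i ∈ X, ∀ j ∈ Y, i ≤ j := by
    set P : Set ℕ := {h | ∃ X ∈ 𝓒, ∃ Y ∈ 𝓓, (∀ i ∈ X, h ≤ a i) ∧ (∀ i ∈ Y, h ≤ a i) ∧
        ∀ i ∈ X, ∀ j ∈ Y, i ≤ j} with hP
    by_cases hne : P.Nonempty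
    · have hfin : P.Finite := by
        refine (Set.finite_iUnion fun q : Fin n => Set.finite_Iic (a q)).subset ?_
        rintro h ⟨X, hX, -, -, hXh, -⟩
        obtain ⟨q, hq⟩ := h𝓒 X hX
        exact Set.mem_iUnion.2 ⟨q, hXh q hq⟩
      obtain ⟨h₀, ⟨X, hX, Y, hY, h1, h2, h3⟩, hmax⟩ := Set.exists_max_image P id hfin hne
      refine ⟨X ∪ Y, ?_, fun h hh => ⟨X, hX, Y, hY, Set.subset_union_left, Set.subset_union_right,
        fun i hi => (hmax h hh).trans (h1 i hi), fun i hi => (hmax h hh).trans (h2 i hi), h3⟩⟩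
      have := Set.ncard_union_le X Y
      have := h𝓒K X hX
      have := h𝓓K Y hY
      omega
    · exact ⟨∅, by simp, fun h hh => absurd ⟨h, hh⟩ hne⟩
  have hrow : ∀ h, RowBlocked a RL RR h → Blocked a 𝓒 𝓓 {T | ∃ i j, RL i j ∧ T = {i, j}}
      {T | ∃ i j, RR i j ∧ T = {i, j}} S₃ h := by
    intro h hh
    obtain ⟨i, j, k, l, hi, hj, hk, hl, hij, hkl, hjk, h1, h2, h3, h4⟩ := hcov₃ h hh
    have := hRL i j hij
    have := hRR k l hkl
    refine ⟨{i, j}, {k, l}, ?_, ?_, .inr ⟨⟨i, j, hij, rfl⟩, ?_⟩, .inr ⟨⟨k, l, hkl, rfl⟩, ?_⟩, ?_⟩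
    · simp [Set.insert_subset_iff, hi, hj]
    · simp [Set.insert_subset_iff, hk, hl]
    · simp [h1, h2]
    · simp [h3, h4]
    · simp only [Set.mem_insert_iff, Set.mem_singleton_iff]
      rintro _ (rfl | rfl) _ (rfl | rfl) <;> omega
  refine ⟨(S₁ ∪ S₂) ∪ (S₃ ∪ S₄), ?_, fun h => ?_⟩
  · have := Set.ncard_union_le (S₁ ∪ S₂) (S₃ ∪ S₄)
    have := Set.ncard_union_le S₁ S₂
    have := Set.ncard_union_le S₃ S₄
    omega
  have hsub₁ : S₁ ⊆ (S₁ ∪ S₂) ∪ (S₃ ∪ S₄) := fun _ h => .inl (.inl h)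
  have hsub₂ : S₂ ⊆ (S₁ ∪ S₂) ∪ (S₃ ∪ S₄) := fun _ h => .inl (.inr h)
  have hsub₃ : S₃ ⊆ (S₁ ∪ S₂) ∪ (S₃ ∪ S₄) := fun _ h => .inr (.inl h)
  have hsub₄ : S₄ ⊆ (S₁ ∪ S₂) ∪ (S₃ ∪ S₄) := fun _ h => .inr (.inr h)
  obtain ⟨X, Y, -, -, ⟨hX, hXh⟩ | ⟨⟨i, j, hij, rfl⟩, hXh⟩, ⟨hY, hYh⟩ | ⟨⟨k, l, hkl, rfl⟩, hYh⟩, hXY⟩ :=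
    hb h
  · obtain ⟨X, hX, Y, hY, hXS, hYS, hXh, hYh, hXY⟩ := hcov₄ h ⟨X, hX, Y, hY, hXh, hYh, hXY⟩
    exact Blocked.mono ⟨X, Y, hXS, hYS, .inl ⟨hX, hXh⟩, .inl ⟨hY, hYh⟩, hXY⟩ hsub₄
  · have hd : Diagonal (fun i : Fin n => (i : ℤ)) a 𝓒 RR Set.univ h :=
      ⟨X, hX, k, l, Set.subset_univ _, trivial, trivial, hXh, hkl, hYh k (by simp),
        hYh l (by simp), fun i hi => by
          have := hXY i hi k (by simp)
          simpa using this⟩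
    rcases hcov₁ h hd with ⟨M, hM, x, y, hMS, hx, hy, hMh, hxy, hxh, hyh, hMx⟩ | hq
    · refine Blocked.mono ⟨M, {x, y}, hMS, ?_, .inl ⟨hM, hMh⟩, .inr ⟨⟨x, y, hxy, rfl⟩, ?_⟩, ?_⟩ hsub₁
      · simp [Set.insert_subset_iff, hx, hy]
      · simp [hxh, hyh]
      · intro i hi j hj
        have hpos := hMx i hi
        dsimp only at hpos
        have := hRR x y hxy
        simp only [Set.mem_insert_iff, Set.mem_singleton_iff] at hj
        rcases hj with rfl | rfl <;> omega
    · exact (hrow h hq).mono hsub₃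
  · have hd : Diagonal (fun i : Fin n => -(i : ℤ)) a 𝓓 (fun x y => RL y x) Set.univ h :=
      ⟨Y, hY, j, i, Set.subset_univ _, trivial, trivial, hYh, hij, hXh j (by simp),
        hXh i (by simp), fun k hk => by
          have := hXY j (by simp) k hk
          simpa using this⟩
    rcases hcov₂ h hd with ⟨M, hM, x, y, hMS, hx, hy, hMh, hxy, hxh, hyh, hMx⟩ | hq
    · refine Blocked.mono ⟨{y, x}, M, ?_, hMS, .inr ⟨⟨y, x, hxy, rfl⟩, ?_⟩, .inl ⟨hM, hMh⟩, ?_⟩ hsub₂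
      · simp [Set.insert_subset_iff, hx, hy]
      · simp [hxh, hyh]
      · intro i hi j hj
        have hpos := hMx j hj
        dsimp only at hpos
        have := hRL y x hxy
        simp only [Set.mem_insert_iff, Set.mem_singleton_iff] at hi
        rcases hi with rfl | rfl <;> omega
    · exact (hrow h hq).mono hsub₃
  · exact (hrow h ⟨i, j, k, l, hij, hkl, hXY j (by simp) k (by simp), hXh i (by simp),
      hXh j (by simp), hYh k (by simp), hYh l (by simp)⟩).mono hsub₃

end Blocked

/-! ### Grid classes -/

/-- Thresholds can be carried over between two functions that order their domain alike. -/
lemma exists_threshold {k : ℕ} {F G : Fin k → ℕ} (hFG : ∀ i j, G i < G j ↔ F i < F j) (t : ℕ) :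
    ∃ t', ∀ j, G j < t ↔ F j < t' := by
  refine ⟨(Finset.univ.filter fun j => G j < t).sup fun j => F j + 1, fun j => ?_⟩
  rw [Finset.lt_sup_iff]
  constructor
  · exact fun hj => ⟨j, by simpa using hj, by omega⟩
  · rintro ⟨i, hi, hij⟩
    have hi' : G i < t := by simpa using hi
    have := hFG i j
    omega

lemma mem_grid_Av_iff {BC BD BL BR : Set Permutation} {π : Permutation} :
    π ∈ Grid !![Av BC, Av BD; Av BL, Av BR] ↔ ∃ v h, ¬ Obstructed (fun i => (π.2 i : ℕ))
      (occ BC π) (occ BD π) (occ BL π) (occ BR π) Set.univ v h := by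
  refine exists_congr fun v => exists_congr fun h => ?_
  simp only [Matrix.of_apply, Matrix.cons_val', Matrix.cons_val_zero, Matrix.cons_val_one,
    Matrix.cons_val_fin_one, cellIn_Av_iff, Obstructed, Set.subset_univ, true_and, not_exists,
    not_or, not_and]
  constructor
  · rintro ⟨h1, h2, h3, h4⟩ T
    exact ⟨h1 T, h2 T, h3 T, h4 T⟩
  · exact fun hh => ⟨fun T => (hh T).1, fun T => (hh T).2.1, fun T => (hh T).2.2.1,
      fun T => (hh T).2.2.2⟩

lemma mem_grid_Av_of_contained {BC BD BL BR : Set Permutation} {π : Permutation}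
    (hπ : π ∈ Grid !![Av BC, Av BD; Av BL, Av BR]) {σ : Permutation} (hσ : Contained σ π) :
    σ ∈ Grid !![Av BC, Av BD; Av BL, Av BR] := by
  rw [mem_grid_Av_iff] at hπ ⊢
  obtain ⟨v, h, hvh⟩ := hπ
  obtain ⟨-, f, rfl, hf⟩ := hσ
  obtain ⟨v', hv'⟩ := exists_threshold (F := fun j : Fin σ.1 => (j : ℕ))
    (G := fun j => (f j : ℕ)) (fun _ _ => f.lt_iff_lt) v
  obtain ⟨h', hh'⟩ := exists_threshold (F := fun j => (σ.2 j : ℕ))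
    (G := fun j => (π.2 (f j) : ℕ)) (fun i j => (hf i j).symm) h
  refine ⟨v', h', fun ⟨T, _, hT⟩ => hvh ⟨f '' T, Set.subset_univ _, ?_⟩⟩
  have himg : ∀ B, T ∈ occ B σ → f '' T ∈ occ B π := fun B ⟨β, hβ, hc⟩ => ⟨β, hβ, hc.image hf⟩
  simp only [Set.forall_mem_image, ← not_lt, hv', hh'] at hT ⊢
  exact hT.imp (And.imp_left (himg _)) <| Or.imp (And.imp_left (himg _)) <|
    Or.imp (And.imp_left (himg _)) (And.imp_left (himg _))

/-- If the horizontal line is blocked at every height by points of `S`, then the permutation formed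
by `S` is not in the grid class. -/
lemma not_mem_grid_Av_of_blocked {BC BD BL BR : Set Permutation} {π : Permutation}
    {S : Set (Fin π.1)} (hb : ∀ h, Blocked (fun i => (π.2 i : ℕ))
      (occ BC π) (occ BD π) (occ BL π) (occ BR π) S h) {σ : Permutation} (hσ : IsCopy σ π S) :
    σ ∉ Grid !![Av BC, Av BD; Av BL, Av BR] := by
  rw [mem_grid_Av_iff]
  rintro ⟨v, h, hvh⟩
  obtain ⟨f, rfl, hf⟩ := hσ
  obtain ⟨v', hv'⟩ := exists_threshold (G := fun j : Fin σ.1 => (j : ℕ))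
    (F := fun j => (f j : ℕ)) (fun _ _ => f.lt_iff_lt.symm) v
  obtain ⟨h', hh'⟩ := exists_threshold (G := fun j => (σ.2 j : ℕ))
    (F := fun j => (π.2 (f j) : ℕ)) hf h
  obtain ⟨T, hTS, hT⟩ := (hb h').obstructed v'
  have hpre : ∀ B, T ∈ occ B π → ∃ T', T' ∈ occ B σ ∧ f '' T' = T := fun B ⟨β, hβ, hc⟩ => by
    obtain ⟨T', h1, h2⟩ := hc.exists_preimage hf hTS
    exact ⟨T', ⟨β, hβ, h1⟩, h2⟩
  apply hvh
  rcases hT with ⟨h1, h2⟩ | ⟨h1, h2⟩ | ⟨h1, h2⟩ | ⟨h1, h2⟩ <;>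
  · obtain ⟨T', hT', rfl⟩ := hpre _ h1
    refine ⟨T', Set.subset_univ _, ?_⟩
    simp only [Set.forall_mem_image, ← not_lt, ← hv', ← hh'] at h2 ⊢
    tauto

/-- The grid class is finitely based if the two top cells are and, over the two bottom cells, whose
forbidden patterns are pairs, successive rungs on either diagonal eventually block the bottom row. -/
theorem finitelyBased_grid {BC BD BL BR : Set Permutation} (hC : BC.Finite) (hD : BD.Finite)
    (hC' : emptyPerm ∉ BC) (hD' : emptyPerm ∉ BD)
    {RL RR : ∀ π : Permutation, Fin π.1 → Fin π.1 → Prop}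
    (hL : ∀ π, occ BL π = {T | ∃ i j, RL π i j ∧ T = {i, j}})
    (hR : ∀ π, occ BR π = {T | ∃ i j, RR π i j ∧ T = {i, j}})
    (hRL : ∀ π i j, RL π i j → i < j) (hRR : ∀ π i j, RR π i j → i < j)
    (hleft : ∀ π, RungBound (fun i : Fin π.1 => (i : ℤ)) (fun i => (π.2 i : ℕ)) (occ BC π) (RR π)
      (RowBlocked (fun i => (π.2 i : ℕ)) (RL π) (RR π)))
    (hright : ∀ π, RungBound (fun i : Fin π.1 => -(i : ℤ)) (fun i => (π.2 i : ℕ)) (occ BD π)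
      (fun x y => RL π y x) (RowBlocked (fun i => (π.2 i : ℕ)) (RL π) (RR π))) :
    FinitelyBased (Grid !![Av BC, Av BD; Av BL, Av BR]) := by
  obtain ⟨K, hK⟩ := ((hC.union hD).image Sigma.fst).bddAbove
  have hne : ∀ B, emptyPerm ∉ B → ∀ π, ∀ T ∈ occ B π, T.Nonempty := fun B hB π T ⟨β, hβ, hT⟩ =>
    hT.nonempty fun h => hB (h ▸ hβ)
  have hpair : ∀ {n : ℕ} {𝓕 : Set (Set (Fin n))} {R : Fin n → Fin n → Prop},
      𝓕 = {T | ∃ i j, R i j ∧ T = {i, j}} → ∀ T ∈ 𝓕, T.Nonempty := by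
    rintro n _ R rfl _ ⟨i, j, -, rfl⟩
    exact ⟨i, by simp⟩
  refine finitelyBased_of_bounded (fun π hπ σ => mem_grid_Av_of_contained hπ) (6 * K + 12)
    fun π hπ => ?_
  simp only [mem_grid_Av_iff, not_exists, not_not] at hπ
  obtain ⟨S, hS, hb⟩ := exists_bounded_blocked (hne BC hC' π) (hne BD hD' π)
    (fun T ⟨β, hβ, hT⟩ => hT.ncard_eq ▸ hK ⟨β, .inl hβ, rfl⟩)
    (fun T ⟨β, hβ, hT⟩ => hT.ncard_eq ▸ hK ⟨β, .inr hβ, rfl⟩) (hL π) (hR π) (hRL π) (hRR π)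
    (hleft π) (hright π) fun h => blocked_of_obstructed (hne BC hC' π) (hne BD hD' π)
      (hpair (hL π)) (hpair (hR π)) fun v => hπ v h
  exact ⟨S, hS, fun σ hσ => not_mem_grid_Av_of_blocked hb hσ⟩

/-! ### Rungs over monotone cells -/

section Monotone

variable {π : Permutation} {𝓜 : Set (Set (Fin π.1))}

/-- The pair of positions `i`, `j` forms a `12`. -/
def Asc (π : Permutation) (i j : Fin π.1) : Prop := i < j ∧ π.2 i < π.2 j

/-- The pair of positions `i`, `j` forms a `21`. -/
def Desc (π : Permutation) (i j : Fin π.1) : Prop := i < j ∧ π.2 j < π.2 i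

/-- The lowest point `m₁` of the first set and the point `x₁` form a `21`, which lies on the left of
the pair of the second rung. -/
lemma rungBound_left_increasing (RR : Fin π.1 → Fin π.1 → Prop) :
    RungBound (fun i : Fin π.1 => (i : ℤ)) (fun i => (π.2 i : ℕ)) 𝓜 RR
      (RowBlocked (fun i => (π.2 i : ℕ)) (Desc π) RR) := by
  refine .of_two fun h₁ u₁ x₁ y₁ m₁ M₁ h₂ u₂ x₂ y₂ m₂ M₂ r₁ r₂ hu hx => ?_
  dsimp only [RowBlocked] at hx ⊢
  have hm := r₁.left m₁ r₁.m_mem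
  have hlt := r₁.x_lt
  have hle := r₁.le
  have heq := r₁.m_eq
  have hx₂ := r₂.x_lt
  have hy₂ := r₂.y_lt
  have hne : m₁ ≠ x₁ := by
    rintro rfl
    omega
  exact ⟨m₁, x₁, x₂, y₂, ⟨by omega, by rw [Fin.lt_def]; omega⟩, r₂.rel, by omega, by omega,
    by omega, hx₂, hy₂⟩

/-- The point `x₁` and the lowest point `m₁` of the first set form a `12`, which lies on the right of
the pair of the second rung. -/
lemma rungBound_right_decreasing (RL : Fin π.1 → Fin π.1 → Prop) :
    RungBound (fun i : Fin π.1 => -(i : ℤ)) (fun i => (π.2 i : ℕ)) 𝓜 (fun x y => RL y x)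
      (RowBlocked (fun i => (π.2 i : ℕ)) RL (Asc π)) := by
  refine .of_two fun h₁ u₁ x₁ y₁ m₁ M₁ h₂ u₂ x₂ y₂ m₂ M₂ r₁ r₂ hu hx => ?_
  dsimp only [RowBlocked] at hx ⊢
  have hm := r₁.left m₁ r₁.m_mem
  have hlt := r₁.x_lt
  have hle := r₁.le
  have heq := r₁.m_eq
  have hx₂ := r₂.x_lt
  have hy₂ := r₂.y_lt
  have hne : m₁ ≠ x₁ := by
    rintro rfl
    omega
  exact ⟨y₂, x₂, x₁, m₁, r₂.rel, ⟨by omega, by rw [Fin.lt_def]; omega⟩, by omega, hy₂, hx₂,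
    by omega, by omega⟩

/-- The points `x₁`, `x₂` form a `12`, which ends where the `21` of the second rung starts. -/
lemma rungBound_left_decreasing_increasing :
    RungBound (fun i : Fin π.1 => (i : ℤ)) (fun i => (π.2 i : ℕ)) 𝓜 (Desc π)
      (RowBlocked (fun i => (π.2 i : ℕ)) (Asc π) (Desc π)) := by
  refine .of_two fun h₁ u₁ x₁ y₁ m₁ M₁ h₂ u₂ x₂ y₂ m₂ M₂ r₁ r₂ hu hx => ?_
  dsimp only [RowBlocked] at hx ⊢
  have hlt := r₁.x_lt
  have hle := r₁.le
  have hx₂ := r₂.x_lt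
  obtain ⟨hxy, hπ⟩ := r₂.rel
  have hbest := r₁.best x₂ y₂ r₂.rel
  -- otherwise `x₂` would be a better choice than `x₁` at the height `h₁`
  have hup : π.2 x₁ < π.2 x₂ := by
    rw [Fin.lt_def] at hπ ⊢
    have hne : (π.2 x₁ : ℕ) ≠ π.2 x₂ := fun h => by
      have := π.2.injective (Fin.ext h)
      subst this
      omega
    omega
  exact ⟨x₁, x₂, x₂, y₂, ⟨by omega, hup⟩, r₂.rel, le_rfl, by omega, hx₂, hx₂, r₂.y_lt⟩

/-- The points `x₂`, `x₁` form a `21`, which starts where the `12` of the second rung ends. -/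
lemma rungBound_right_decreasing_increasing :
    RungBound (fun i : Fin π.1 => -(i : ℤ)) (fun i => (π.2 i : ℕ)) 𝓜 (fun x y => Asc π y x)
      (RowBlocked (fun i => (π.2 i : ℕ)) (Asc π) (Desc π)) := by
  refine .of_two fun h₁ u₁ x₁ y₁ m₁ M₁ h₂ u₂ x₂ y₂ m₂ M₂ r₁ r₂ hu hx => ?_
  dsimp only [RowBlocked] at hx ⊢
  have hlt := r₁.x_lt
  have hle := r₁.le
  have hx₂ := r₂.x_lt
  obtain ⟨hxy, hπ⟩ := r₂.rel
  have hbest := r₁.best x₂ y₂ r₂.rel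
  -- otherwise `x₂` would be a better choice than `x₁` at the height `h₁`
  have hup : π.2 x₁ < π.2 x₂ := by
    rw [Fin.lt_def] at hπ ⊢
    have hne : (π.2 x₁ : ℕ) ≠ π.2 x₂ := fun h => by
      have := π.2.injective (Fin.ext h)
      subst this
      omega
    omega
  exact ⟨y₂, x₂, x₂, x₁, r₂.rel, ⟨by omega, hup⟩, le_rfl, r₂.y_lt, hx₂, hx₂, by omega⟩

/-- Either the pairs of the first two rungs block the bottom row, or `x₂`, `x₁` form a `21` that does
so together with the pair of the third rung. -/
lemma rungBound_right_increasing_increasing :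
    RungBound (fun i : Fin π.1 => -(i : ℤ)) (fun i => (π.2 i : ℕ)) 𝓜 (fun x y => Desc π y x)
      (RowBlocked (fun i => (π.2 i : ℕ)) (Desc π) (Desc π)) := by
  intro h₁ u₁ x₁ y₁ m₁ M₁ h₂ u₂ x₂ y₂ m₂ M₂ h₃ u₃ x₃ y₃ m₃ M₃ r₁ r₂ r₃ hu₁ hu₂ hx₁₂ hx₂₃
  dsimp only [RowBlocked] at hx₁₂ hx₂₃ ⊢
  have := r₁.x_lt
  have := r₁.y_lt
  have := r₁.le
  have := r₂.x_lt
  have := r₂.y_lt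
  have := r₂.le
  obtain ⟨hxy₁, hπ₁⟩ := r₁.rel
  obtain ⟨hxy₂, hπ₂⟩ := r₂.rel
  by_cases hcross : x₂ ≤ y₁
  · exact ⟨y₂, x₂, y₁, x₁, r₂.rel, r₁.rel, hcross, by omega, by omega, by omega, by omega⟩
  -- otherwise `x₂` would be a better choice than `x₁` at the height `h₁`
  have hup : π.2 y₁ ≤ π.2 x₂ := by
    by_contra hc
    have hd : Desc π y₁ x₂ := ⟨not_le.1 hcross, not_le.1 hc⟩
    have hc' := not_le.1 hc
    rw [Fin.lt_def] at hc'
    have := r₁.best x₂ y₁ hd (by omega) (by omega)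
    omega
  exact ⟨y₃, x₃, x₂, x₁, r₃.rel, ⟨by omega, hπ₁.trans_le hup⟩, by omega, r₃.y_lt, r₃.x_lt,
    by omega, by omega⟩

end Monotone

lemma IsPermClass.emptyPerm_notMem {B : Set Permutation} (h : IsPermClass (Av B)) :
    emptyPerm ∉ B := fun hB =>
  h.empty_mem _ hB ⟨_, .refl _, rfl, fun _ _ => Iff.rfl⟩

end PermPattern

theorem theorem2 (C D : Set PermPattern.Permutation)
    (hC : PermPattern.IsPermClass C) (hD : PermPattern.IsPermClass D)
    (hCfin : PermPattern.FinitelyBased C) (hDfin : PermPattern.FinitelyBased D) :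
    PermPattern.FinitelyBased
      (PermPattern.Grid !![C, D; PermPattern.Increasing, PermPattern.Increasing]) ∧
    PermPattern.FinitelyBased
      (PermPattern.Grid !![C, D; PermPattern.Increasing, PermPattern.Decreasing]) ∧
    PermPattern.FinitelyBased
      (PermPattern.Grid !![C, D; PermPattern.Decreasing, PermPattern.Increasing]) := by
  obtain ⟨BC, ⟨⟨rfl, -⟩, hBC⟩⟩ := hCfin
  obtain ⟨BD, ⟨⟨rfl, -⟩, hBD⟩⟩ := hDfin
  have hC' := hC.emptyPerm_notMem
  have hD' := hD.emptyPerm_notMem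
  open PermPattern in
  exact
    ⟨finitelyBased_grid hBC hBD hC' hD' (RL := Desc) (RR := Desc) occ_perm21 occ_perm21
      (fun _ _ _ h => h.1) (fun _ _ _ h => h.1) (fun _ => rungBound_left_increasing _)
      (fun _ => rungBound_right_increasing_increasing),
    finitelyBased_grid hBC hBD hC' hD' (RL := Desc) (RR := Asc) occ_perm21 occ_perm12
      (fun _ _ _ h => h.1) (fun _ _ _ h => h.1) (fun _ => rungBound_left_increasing _)
      (fun _ => rungBound_right_decreasing _),
    finitelyBased_grid hBC hBD hC' hD' (RL := Asc) (RR := Desc) occ_perm12 occ_perm21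
      (fun _ _ _ h => h.1) (fun _ _ _ h => h.1)
      (fun _ => rungBound_left_decreasing_increasing)
      (fun _ => rungBound_right_decreasing_increasing)⟩
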